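/- Let $\ell,n\ge 0$ be integers, let $\mathrm{Sym}(n,\mathbb{R})$ be the space of real symmetric $n\times n$ matrices, let $\mathbb{1}$ be the identity matrix, and let $S^\ell\subset\mathbb{R}^{\ell+1}$ be the unit sphere. For $\mathcal{R}=(R_1,\ldots,R_\ell)\in\mathrm{Sym}(n,\mathbb{R})^\ell$ and $x=(x_0,\ldots,x_\ell)\in S^\ell$ put $A(x)=x_0\mathbb{1}+x_1R_1+\cdots+x_\ell R_\ell$. Consider the spectrahedron $\mathscr{S}_{\ell,n}=\{x\in S^\ell : A(x)\text{ is positive semidefinite}\}$ and the symmetroid $\Sigma_{\ell,n}=\{x\in S^\ell : \det A(x)=0\}$, and for $k\ge 0$ let $\mathscr{S}^{(k)}_{\ell,n}$ and $\Sigma^{(k)}_{\ell,n}$ be the sets of those $x$ in $\mathscr{S}_{\ell,n}$, respectively in $\Sigma_{\ell,n}$, for which $A(x)$ has corank $k$ (that is, rank $n-k$). Then for generic $\mathcal{R}$, that is, for all $\mathcal{R}$ outside a proper real algebraic subset of $\mathrm{Sym}(n,\mathbb{R})^\ell$, and for every $k\ge 0$, each of the sets $\mathscr{S}^{(k)}_{\ell,n}$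 and $\Sigma^{(k)}_{\ell,n}$ is either empty or a semialgebraic subset of $S^\ell$ of codimension $\binom{k+1}{2}$, that is, of dimension $\ell-\binom{k+1}{2}$. Here the dimension of a nonempty semialgebraic set is the largest dimension of a smooth embedded submanifold contained in it. -/

import Mathlib

open scoped ContDiff

/-- The space `Sym(n, ℝ)` of real symmetric `n × n` matrices. -/
abbrev SymMat (n : ℕ) : Type := {M : Matrix (Fin n) (Fin n) ℝ // M.IsSymm}

/-- The sphere `S^ℓ`, the unit sphere of `ℝ^(ℓ+1)`, with coordinates `x 0, x 1, …, x ℓ`. -/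
def unitSphere (l : ℕ) : Set (EuclideanSpace ℝ (Fin (l + 1))) := Metric.sphere 0 1

/-- The matrix `x₀ 𝟙 + x₁ R₁ + ⋯ + x_ℓ R_ℓ`. -/
noncomputable def pencil {l n : ℕ} (R : Fin l → SymMat n)
    (x : EuclideanSpace ℝ (Fin (l + 1))) : Matrix (Fin n) (Fin n) ℝ :=
  x 0 • (1 : Matrix (Fin n) (Fin n) ℝ) + ∑ i : Fin l, x i.succ • (R i : Matrix (Fin n) (Fin n) ℝ)

/-- The (spherical) spectrahedron of `R`. -/
def spectrahedron {l n : ℕ} (R : Fin l → SymMat n) : Set (EuclideanSpace ℝ (Fin (l + 1))) :=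
  {x | x ∈ unitSphere l ∧ (pencil R x).PosSemidef}

/-- The symmetroid hypersurface of `R`. -/
def symmetroid {l n : ℕ} (R : Fin l → SymMat n) : Set (EuclideanSpace ℝ (Fin (l + 1))) :=
  {x | x ∈ unitSphere l ∧ (pencil R x).det = 0}

/-- The points of `S^ℓ` at which the matrix `x₀ 𝟙 + x₁ R₁ + ⋯ + x_ℓ R_ℓ` has corank `k`. -/
def corankLocus {l n : ℕ} (R : Fin l → SymMat n) (k : ℕ) :
    Set (EuclideanSpace ℝ (Fin (l + 1))) :=
  {x | x ∈ unitSphere l ∧ (pencil R x).rank + k = n}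

/-- Semialgebraic subsets of `ℝ^m`: the smallest family of sets that contains the sets `{p > 0}`,
`p` a real polynomial, and is closed under complements and finite unions
(hence under finite intersections; `{p = 0}` is the complement of `{p > 0} ∪ {-p > 0}`). -/
inductive IsSemialgebraic {m : ℕ} : Set (EuclideanSpace ℝ (Fin m)) → Prop
  | pos (p : MvPolynomial (Fin m) ℝ) :
      IsSemialgebraic {x | 0 < MvPolynomial.eval (fun i => x i) p}
  | compl (A : Set (EuclideanSpace ℝ (Fin m))) : IsSemialgebraic A → IsSemialgebraic Aᶜ
  | union (A B : Set (EuclideanSpace ℝ (Fin m))) :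
      IsSemialgebraic A → IsSemialgebraic B → IsSemialgebraic (A ∪ B)

/-- `A` contains a nonempty `d`-dimensional smooth embedded submanifold of `ℝ^m`, here given by a
parametrization: a smooth embedding (an immersion that is a homeomorphism onto its image) of a
nonempty open set `V ⊆ ℝ^d` with image in `A`. -/
def ContainsSubmanifold {m : ℕ} (A : Set (EuclideanSpace ℝ (Fin m))) (d : ℕ) : Prop :=
  ∃ (V : Set (EuclideanSpace ℝ (Fin d)))
    (ψ : EuclideanSpace ℝ (Fin d) → EuclideanSpace ℝ (Fin m)),
    IsOpen V ∧ V.Nonempty ∧ ContDiffOn ℝ ∞ ψ V ∧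
    (∀ v ∈ V, Function.Injective (fderiv ℝ ψ v)) ∧
    Topology.IsEmbedding (fun v : V => ψ v) ∧ Set.MapsTo ψ V A

/-- The semialgebraic set `A` has dimension `d`: this is the largest dimension of a smooth
submanifold contained in `A`. (The empty set has no dimension in `ℕ`.) -/
def HasDimension {m : ℕ} (A : Set (EuclideanSpace ℝ (Fin m))) (d : ℕ) : Prop :=
  IsGreatest {e : ℕ | ContainsSubmanifold A e} d

/-- `A` is a subset of `S^ℓ` of codimension `c` in `S^ℓ`, that is, of dimension `ℓ - c`
(in particular `c ≤ ℓ`). -/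
def HasCodimensionInSphere {l : ℕ} (A : Set (EuclideanSpace ℝ (Fin (l + 1)))) (c : ℕ) : Prop :=
  A ⊆ unitSphere l ∧ ∃ d : ℕ, HasDimension A d ∧ d + c = l

/-- `P R` holds for a generic tuple `R ∈ Sym(n, ℝ)^ℓ`: it holds outside the zero set of a
polynomial in the entries of the matrices that does not vanish identically on `Sym(n, ℝ)^ℓ`,
that is, outside a proper real algebraic subset. -/
def ForGenericTuple {l n : ℕ} (P : (Fin l → SymMat n) → Prop) : Prop :=
  ∃ p : MvPolynomial (Fin l × Fin n × Fin n) ℝ,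
    (∃ R : Fin l → SymMat n, MvPolynomial.eval (fun t => (R t.1).1 t.2.1 t.2.2) p ≠ 0) ∧
    ∀ R : Fin l → SymMat n, MvPolynomial.eval (fun t => (R t.1).1 t.2.1 t.2.2) p ≠ 0 → P R

/-!
For generic `R` the pencil `A(x) = x₀ 𝟙 + ∑ xᵢ Rᵢ` is transversal to the rank strata of the space
of symmetric matrices, and near a matrix of corank `k` the stratum is the zero set of a submersion
to the symmetric `k × k` matrices, a space of dimension `(k + 1).choose 2`.

*Transversality.* The conormal vectors at `M` of the stratum through `M` are the symmetric `Q` with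
`M Q = 0`. So the pencil fails to be transversal at `x` iff some symmetric `Q ≠ 0` has `A(x) Q = 0`
and `tr (A(y) Q) = 0` for all `y` (`IsTransversal`). These are polynomial equations in the entries
of `R`, `x` and `Q`. If eliminating `x` and `Q` gave no nontrivial equation for `R`, then the system
would have a solution over a finite extension `K` of the field of rational functions in the entries
of `R`, these entries being the coordinate functions
(`exists_ne_zero_forall_eval_eq_zero`). Every partial derivative `D` with respect to these entries
extends to `K`. Differentiating `A(x) Q = 0` and taking traces leaves `∑ xᵢ tr (Q (D Rᵢ)) = 0`;
here `tr (A(x) (D Q))` drops out because `Q = Q G Q` for some `G`. Taking for `D` the derivative in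
a suitable entry of `Rᵢ` contradicts `xᵢ ≠ 0` and `Q ≠ 0`
(`IsDegenerate.false_of_derivations`). This is an algebraic form of Sard's theorem; it yields a
polynomial directly.

*Local structure.* In an eigenbasis of `A(x₀)` the equations of the stratum are the entries of a
Schur complement, and transversality says that their derivatives along the pencil are independent
(`exists_equations_corankLocus`). Since the Schur complement vanishes at `x₀` together with its
derivative in the radial direction `x₀`, the equation of the sphere is independent of them. The
inverse function theorem gives the submanifold of the expected dimension, and an immersion into a
fibre of a submersion cannot have larger dimension.

*Semidefiniteness.* Rank and positive semidefiniteness of a symmetric matrix `M` are read off from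
the coefficients of `det (X + M)`. This shows that all the sets are semialgebraic, and that the
positive semidefinite matrices are relatively open in each corank locus, so the spectrahedron needs
no separate argument.
-/

open Filter Topology Module

/-! ### Elimination by derivations -/

/-- A derivation of a polynomial ring `k[σ]` along a variable extends to every field that is finite
over the field of rational functions. -/
theorem exists_derivation_extending_pderiv {σ k F K : Type} [DecidableEq σ] [Field k]
    [CharZero k] [Field F]
    [Algebra (MvPolynomial σ k) F] [IsFractionRing (MvPolynomial σ k) F] [Field K] [Algebra F K]
    [Module.Finite F K] (s : σ) :
    ∃ D : Derivation ℤ K K, ∀ s' : σ,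
      D (algebraMap F K (algebraMap (MvPolynomial σ k) F (MvPolynomial.X s'))) =
        if s = s' then 1 else 0 := by
  let _ : Algebra (MvPolynomial σ k) K :=
    ((algebraMap F K).comp (algebraMap (MvPolynomial σ k) F)).toAlgebra
  have : IsScalarTower (MvPolynomial σ k) F K := IsScalarTower.of_algebraMap_eq fun _ => rfl
  have : CharZero F := charZero_of_injective_algebraMap
    (IsFractionRing.injective (MvPolynomial σ k) F)
  have : Algebra.FormallyEtale (MvPolynomial σ k) F :=
    Algebra.FormallyEtale.of_isLocalization (nonZeroDivisors (MvPolynomial σ k))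
  have : Algebra.FormallyEtale F K := Algebra.FormallyEtale.of_isSeparable F K
  have : Algebra.FormallyEtale (MvPolynomial σ k) K := Algebra.FormallyEtale.comp _ F _
  let d : Derivation ℤ (MvPolynomial σ k) K :=
    (Algebra.linearMap (MvPolynomial σ k) K).compDer ((MvPolynomial.pderiv s).restrictScalars ℤ)
  let e := KaehlerDifferential.tensorKaehlerEquivOfFormallyEtale ℤ (MvPolynomial σ k) K
  let g := (d.liftKaehlerDifferential.liftBaseChange K).comp e.symm.toLinearMap
  refine ⟨g.compDer (KaehlerDifferential.D ℤ K), fun s' => ?_⟩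
  have h := KaehlerDifferential.tensorKaehlerEquivOfFormallyEtale_symm_D_algebraMap ℤ
    (MvPolynomial σ k) K (MvPolynomial.X s')
  refine (congrArg (d.liftKaehlerDifferential.liftBaseChange K) h).trans ?_
  rw [LinearMap.liftBaseChange_tmul, Derivation.liftKaehlerDifferential_comp_D, one_smul]
  change algebraMap (MvPolynomial σ k) K (MvPolynomial.pderiv s (MvPolynomial.X s')) = _
  rw [MvPolynomial.pderiv_X, Pi.single_apply]
  simp only [eq_comm (a := s') (b := s)]
  split_ifs <;> simp

theorem map_eval₂Hom_intCast {ι S T : Type*} [CommRing S] [CommRing T] (φ : S →+* T) (g : ι → S)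
    (f : MvPolynomial ι ℤ) :
    φ (MvPolynomial.eval₂Hom (Int.castRingHom S) g f) =
      MvPolynomial.eval₂Hom (Int.castRingHom T) (fun i => φ (g i)) f := by
  rw [MvPolynomial.map_eval₂Hom]
  congr 2
  exact RingHom.ext_int _ _

attribute [local instance] MvPolynomial.algebraMvPolynomial in
/-- Elimination. Let `Z` be a set of real points with coordinates indexed by `σ` and `τ`. If the
integral equations of `Z` have no solution over a field of characteristic zero in which the
coordinates of `σ` can be differentiated independently, then the `σ`-coordinates of the points of
`Z` satisfy a nontrivial equation. -/
theorem exists_ne_zero_forall_eval_eq_zero {σ τ : Type} [DecidableEq σ] [Finite τ]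
    (Z : Set ((σ → ℝ) × (τ → ℝ)))
    (h : ∀ (K : Type) [Field K] [CharZero K] (a : σ → K) (v : τ → K),
      (∀ f : MvPolynomial (σ ⊕ τ) ℤ,
        (∀ z ∈ Z, MvPolynomial.eval₂Hom (Int.castRingHom _) (Sum.elim z.1 z.2) f = 0) →
        MvPolynomial.eval₂Hom (Int.castRingHom _) (Sum.elim a v) f = 0) →
      (∀ s, ∃ D : Derivation ℤ K K, ∀ s', D (a s') = if s = s' then 1 else 0) → False) :
    ∃ p : MvPolynomial σ ℝ, p ≠ 0 ∧ ∀ z ∈ Z, MvPolynomial.eval z.1 p = 0 := by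
  let A := MvPolynomial σ ℝ
  let F := FractionRing A
  let J : Ideal (MvPolynomial τ A) :=
    ⨅ z ∈ Z, RingHom.ker (MvPolynomial.eval₂Hom (MvPolynomial.eval z.1) z.2)
  have hJ : ∀ f, f ∈ J ↔ ∀ z ∈ Z, MvPolynomial.eval₂Hom (MvPolynomial.eval z.1) z.2 f = 0 := by
    intro f; simp [J, Submodule.mem_iInf, RingHom.mem_ker]
  -- `F[τ]` is the localization of `A[τ]` at the nonzero constants, so the extension of `J` to `F[τ]`
  -- is proper unless `J` contains a nonzero constant, that is, an equation in `σ` alone.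
  by_cases hd : Disjoint
      (((nonZeroDivisors A).map (MvPolynomial.C (σ := τ)) : Submonoid (MvPolynomial τ A)) :
        Set (MvPolynomial τ A)) (J : Set _)
  · exfalso
    rw [← IsLocalization.map_algebraMap_ne_top_iff_disjoint
      ((nonZeroDivisors A).map (MvPolynomial.C (σ := τ))) (MvPolynomial τ F)] at hd
    obtain ⟨m, hm, hle⟩ := Ideal.exists_le_maximal _ hd
    let _ : Field (MvPolynomial τ F ⧸ m) := Ideal.Quotient.field m
    -- Zariski's lemma
    have : Module.Finite F (MvPolynomial τ F ⧸ m) := finite_of_finite_type_of_isJacobsonRing _ _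
    have : CharZero F := charZero_of_injective_algebraMap (IsFractionRing.injective A F)
    have : CharZero (MvPolynomial τ F ⧸ m) :=
      charZero_of_injective_algebraMap (algebraMap F (MvPolynomial τ F ⧸ m)).injective
    refine h (MvPolynomial τ F ⧸ m)
      (fun s => algebraMap F _ (algebraMap A F (MvPolynomial.X s)))
      (fun t => Ideal.Quotient.mk m (MvPolynomial.X t)) (fun f hf => ?_)
      (fun s => exists_derivation_extending_pderiv s)
    let f' : MvPolynomial τ A := MvPolynomial.eval₂Hom (Int.castRingHom _)
      (Sum.elim (fun s => MvPolynomial.C (MvPolynomial.X s)) MvPolynomial.X) f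
    have hf' : f' ∈ J := by
      rw [hJ]
      intro z hz
      rw [← hf z hz]
      simp only [f', map_eval₂Hom_intCast]
      congr 2
      ext (s | t) <;> simp
    have h0 : Ideal.Quotient.mk m (MvPolynomial.map (algebraMap A F) f') = 0 :=
      Ideal.Quotient.eq_zero_iff_mem.2
        (hle (Ideal.mem_map_of_mem (algebraMap _ (MvPolynomial τ F)) hf'))
    have h1 := map_eval₂Hom_intCast ((Ideal.Quotient.mk m).comp (MvPolynomial.map (algebraMap A F)))
      (Sum.elim (fun s => MvPolynomial.C (MvPolynomial.X s)) MvPolynomial.X) f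
    refine Eq.trans ?_ (h1.symm.trans h0)
    refine congrArg (fun g => MvPolynomial.eval₂Hom
      (Int.castRingHom (MvPolynomial τ F ⧸ m)) g f) ?_
    ext (s | t)
    · simp only [RingHom.comp_apply, Sum.elim_inl, MvPolynomial.map_C]
      rfl
    · simp only [RingHom.comp_apply, Sum.elim_inr, MvPolynomial.map_X]
  · obtain ⟨_, ⟨p, hp, rfl⟩, hpJ⟩ := Set.not_disjoint_iff.mp hd
    refine ⟨p, nonZeroDivisors.ne_zero hp, fun z hz => ?_⟩
    simpa using (hJ _).1 hpJ z hz

/-! ### Degenerate pencils -/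

/-- The symmetric matrix whose entries at `(a, b)` and `(b, a)` are the value of `q` at the
unordered pair `s(a, b)`. -/
def symMatrix {n : ℕ} {S : Type*} (q : Sym2 (Fin n) → S) : Matrix (Fin n) (Fin n) S :=
  Matrix.of fun a b => q s(a, b)

/-- The linear combination `x₀ 𝟙 + ∑ xᵢ Rᵢ` over an arbitrary commutative ring, the symmetric
matrices `Rᵢ` being given by their entries `r (i, ·)` on unordered pairs. -/
def symPencil {l n : ℕ} {S : Type*} [CommRing S] (r : Fin l × Sym2 (Fin n) → S)
    (x : Fin (l + 1) → S) : Matrix (Fin n) (Fin n) S :=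
  x 0 • (1 : Matrix (Fin n) (Fin n) S) +
    ∑ i : Fin l, x i.succ • symMatrix fun z => r (i, z)

/-- `(x, q)` witnesses that the pencil given by `r` is not transversal to the rank strata of
symmetric matrices: the symmetric matrix `Q` of `q` is annihilated by the member `x` of the pencil
(so it is a conormal vector of the rank stratum of that member) and orthogonal to all members.
The two normalizations make the condition a system of polynomial equations that excludes `Q = 0`
and the multiples of the identity matrix as members. -/
structure IsDegenerate {l n : ℕ} {S : Type*} [CommRing S] (r : Fin l × Sym2 (Fin n) → S)
    (x : Fin (l + 1) → S) (q : Sym2 (Fin n) → S) : Prop where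
  mul_eq_zero : ∀ a b, (symPencil r x * symMatrix q) a b = 0
  trace_eq_zero : (symMatrix q).trace = 0
  trace_mul_eq_zero : ∀ i, ((symMatrix fun z => r (i, z)) * symMatrix q).trace = 0
  sum_sq_eq_one : ∑ i : Fin l, x i.succ ^ 2 = 1
  sum_sq_eq_one' : ∑ z, q z ^ 2 = 1

section

variable {l n : ℕ} {S T : Type*} [CommRing S] [CommRing T]

theorem symMatrix_transpose {S : Type*} (q : Sym2 (Fin n) → S) :
    (symMatrix q).transpose = symMatrix q := by
  ext a b
  simp [symMatrix, Sym2.eq_swap]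

theorem map_symMatrix {S T : Type*} (φ : S → T) (q : Sym2 (Fin n) → S) :
    (symMatrix q).map φ = symMatrix fun z => φ (q z) := rfl

theorem symPencil_transpose (r : Fin l × Sym2 (Fin n) → S) (x : Fin (l + 1) → S) :
    (symPencil r x).transpose = symPencil r x := by
  simp [symPencil, Matrix.transpose_sum, symMatrix_transpose]

theorem map_symPencil (φ : S →+* T) (r : Fin l × Sym2 (Fin n) → S) (x : Fin (l + 1) → S) :
    (symPencil r x).map φ = symPencil (fun z => φ (r z)) fun i => φ (x i) := by
  ext a b
  simp [symPencil, Matrix.sum_apply, symMatrix, Matrix.one_apply, apply_ite φ]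

theorem map_symPencil_mul_symMatrix_apply (φ : S →+* T) (r : Fin l × Sym2 (Fin n) → S)
    (x : Fin (l + 1) → S) (q : Sym2 (Fin n) → S) (a b : Fin n) :
    φ ((symPencil r x * symMatrix q) a b) =
      (symPencil (fun z => φ (r z)) (fun i => φ (x i)) * symMatrix fun z => φ (q z)) a b := by
  rw [← map_symPencil, ← map_symMatrix φ q, ← Matrix.map_mul]
  rfl

theorem map_trace_symMatrix (φ : S →+* T) (q : Sym2 (Fin n) → S) :
    φ (symMatrix q).trace = (symMatrix fun z => φ (q z)).trace := by
  simp [Matrix.trace, symMatrix]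

theorem map_trace_symMatrix_mul (φ : S →+* T) (p q : Sym2 (Fin n) → S) :
    φ (symMatrix p * symMatrix q).trace =
      ((symMatrix fun z => φ (p z)) * symMatrix fun z => φ (q z)).trace := by
  simp [Matrix.trace, symMatrix, Matrix.mul_apply]

theorem map_sum_sq_sub_one {ι : Type*} [Fintype ι] (φ : S →+* T) (g : ι → S) :
    φ (∑ i, g i ^ 2 - 1) = ∑ i, φ (g i) ^ 2 - 1 := by
  simp only [map_sub, map_sum, map_pow, map_one]

end

/-- Degeneracy is expressed by integral polynomial equations: a triple over any ring that satisfies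
all the integral polynomial equations satisfied by the real degenerate triples is degenerate. -/
theorem isDegenerate_of_forall_eval_eq_zero {l n : ℕ} {T : Type*} [CommRing T]
    {a : Fin l × Sym2 (Fin n) → T} {v : Fin (l + 1) ⊕ Sym2 (Fin n) → T}
    (h : ∀ f : MvPolynomial ((Fin l × Sym2 (Fin n)) ⊕ (Fin (l + 1) ⊕ Sym2 (Fin n))) ℤ,
      (∀ (r : Fin l × Sym2 (Fin n) → ℝ) (w : Fin (l + 1) ⊕ Sym2 (Fin n) → ℝ),
        IsDegenerate r (fun i => w (Sum.inl i)) (fun z => w (Sum.inr z)) →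
        MvPolynomial.eval₂Hom (Int.castRingHom _) (Sum.elim r w) f = 0) →
      MvPolynomial.eval₂Hom (Int.castRingHom _) (Sum.elim a v) f = 0) :
    IsDegenerate a (fun i => v (Sum.inl i)) (fun z => v (Sum.inr z)) := by
  let r₀ : Fin l × Sym2 (Fin n) →
      MvPolynomial ((Fin l × Sym2 (Fin n)) ⊕ (Fin (l + 1) ⊕ Sym2 (Fin n))) ℤ :=
    fun z => MvPolynomial.X (Sum.inl z)
  let x₀ : Fin (l + 1) →
      MvPolynomial ((Fin l × Sym2 (Fin n)) ⊕ (Fin (l + 1) ⊕ Sym2 (Fin n))) ℤ :=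
    fun i => MvPolynomial.X (Sum.inr (Sum.inl i))
  let q₀ : Sym2 (Fin n) →
      MvPolynomial ((Fin l × Sym2 (Fin n)) ⊕ (Fin (l + 1) ⊕ Sym2 (Fin n))) ℤ :=
    fun z => MvPolynomial.X (Sum.inr (Sum.inr z))
  refine ⟨fun c d => ?_, ?_, fun i => ?_, ?_, ?_⟩
  · simpa [map_symPencil_mul_symMatrix_apply, r₀, x₀, q₀] using
      h ((symPencil r₀ x₀ * symMatrix q₀) c d) fun r w hw => by
        simpa [map_symPencil_mul_symMatrix_apply, r₀, x₀, q₀] using hw.mul_eq_zero c d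
  · simpa [map_trace_symMatrix, q₀] using
      h (symMatrix q₀).trace fun r w hw => by
        simpa [map_trace_symMatrix, q₀] using hw.trace_eq_zero
  · simpa [map_trace_symMatrix_mul, r₀, q₀] using
      h ((symMatrix fun z => r₀ (i, z)) * symMatrix q₀).trace fun r w hw => by
        simpa [map_trace_symMatrix_mul, r₀, q₀] using hw.trace_mul_eq_zero i
  · have e := h (∑ i : Fin l, x₀ i.succ ^ 2 - 1) fun r w hw => by
      rw [map_sum_sq_sub_one, sub_eq_zero]
      simpa only [x₀, MvPolynomial.eval₂Hom_X', Sum.elim_inr] using hw.sum_sq_eq_one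
    rw [map_sum_sq_sub_one, sub_eq_zero] at e
    simpa only [x₀, MvPolynomial.eval₂Hom_X', Sum.elim_inr] using e
  · have e := h (∑ z, q₀ z ^ 2 - 1) fun r w hw => by
      rw [map_sum_sq_sub_one, sub_eq_zero]
      simpa only [q₀, MvPolynomial.eval₂Hom_X', Sum.elim_inr] using hw.sum_sq_eq_one'
    rw [map_sum_sq_sub_one, sub_eq_zero] at e
    simpa only [q₀, MvPolynomial.eval₂Hom_X', Sum.elim_inr] using e

/-- Every square matrix over a field has a generalized inverse. -/
theorem exists_mul_mul_eq_self {n : ℕ} {K : Type*} [Field K] (Q : Matrix (Fin n) (Fin n) K) :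
    ∃ G, Q * G * Q = Q := by
  obtain ⟨g, hg⟩ := (Matrix.toLin' Q).rangeRestrict.exists_rightInverse_of_surjective
    (LinearMap.range_rangeRestrict _)
  obtain ⟨g', hg'⟩ := LinearMap.exists_extend g
  refine ⟨LinearMap.toMatrix' g', ?_⟩
  apply Matrix.toLin'.injective
  refine LinearMap.pi_ext' fun j => LinearMap.ext_ring ?_
  rw [Matrix.toLin'_mul, Matrix.toLin'_mul, Matrix.toLin'_toMatrix']
  have h1 := LinearMap.congr_fun hg' ((Matrix.toLin' Q).rangeRestrict (Pi.single j 1))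
  have h2 := LinearMap.congr_fun hg ((Matrix.toLin' Q).rangeRestrict (Pi.single j 1))
  change g' (Matrix.toLin' Q (Pi.single j 1)) = _ at h1
  change Matrix.toLin' Q (g' (Matrix.toLin' Q (Pi.single j 1))) = _
  rw [h1]
  exact congrArg Subtype.val h2

/-- A degenerate triple does not exist over a field in which the entries of the pencil can be
differentiated independently. -/
theorem IsDegenerate.false_of_derivations {l n : ℕ} {K : Type*} [Field K] [CharZero K]
    {r : Fin l × Sym2 (Fin n) → K} {x : Fin (l + 1) → K} {q : Sym2 (Fin n) → K}
    (h : IsDegenerate r x q)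
    (hD : ∀ s, ∃ D : Derivation ℤ K K, ∀ s', D (r s') = if s = s' then 1 else 0) : False := by
  obtain ⟨i, -, hi⟩ : ∃ i ∈ Finset.univ, x (Fin.succ i) ^ 2 ≠ 0 :=
    Finset.exists_ne_zero_of_sum_ne_zero (h.sum_sq_eq_one ▸ one_ne_zero)
  obtain ⟨z, -, hz⟩ : ∃ z ∈ Finset.univ, q z ^ 2 ≠ 0 :=
    Finset.exists_ne_zero_of_sum_ne_zero (h.sum_sq_eq_one' ▸ one_ne_zero)
  obtain ⟨D, hD⟩ := hD (i, z)
  set A := symPencil r x with hA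
  set Q := symMatrix q with hQ
  have hAQ : A * Q = 0 := Matrix.ext h.mul_eq_zero
  have hQA : Q * A = 0 := by
    have := congrArg Matrix.transpose hAQ
    rwa [Matrix.transpose_mul, symPencil_transpose, symMatrix_transpose,
      Matrix.transpose_zero] at this
  have hmul : ∀ M N : Matrix (Fin n) (Fin n) K, (M * N).map D = M.map D * N + M * N.map D := by
    intro M N
    ext a b
    simp only [Matrix.map_apply, Matrix.mul_apply, Matrix.add_apply, map_sum, Derivation.leibniz,
      smul_eq_mul, ← Finset.sum_add_distrib]
    exact Finset.sum_congr rfl fun c _ => by ring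
  -- `A (D Q)` need not vanish, but its trace does, because `Q = Q G Q`.
  obtain ⟨G, hG⟩ := exists_mul_mul_eq_self Q
  have hDQ : (A * Q.map D).trace = 0 := by
    have h1 : Q.map D = Q.map D * (G * Q) + Q * (G * Q).map D := by
      rw [← hmul, ← mul_assoc, hG]
    rw [h1, mul_add, ← mul_assoc A Q, hAQ, zero_mul, add_zero, ← mul_assoc, ← mul_assoc,
      Matrix.trace_mul_comm, ← mul_assoc, ← mul_assoc, hQA]
    simp
  have hDA : (A.map D * Q).trace = 0 := by
    have h1 : A.map D * Q + A * Q.map D = 0 := by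
      rw [← hmul, hAQ]
      ext a b
      simp
    have h2 := congrArg Matrix.trace h1
    rwa [Matrix.trace_add, hDQ, add_zero, Matrix.trace_zero] at h2
  have hA' : A.map D = D (x 0) • (1 : Matrix (Fin n) (Fin n) K) +
      ∑ j, (D (x (Fin.succ j)) • (symMatrix fun z => r (j, z)) +
        x j.succ • symMatrix fun z => D (r (j, z))) := by
    ext a b
    simp only [hA, symPencil, Matrix.map_apply, Matrix.add_apply, Matrix.smul_apply, map_add,
      Matrix.sum_apply, map_sum, smul_eq_mul, Derivation.leibniz, Matrix.one_apply, symMatrix,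
      Matrix.of_apply]
    congr 1
    · split_ifs <;> simp
    · exact Finset.sum_congr rfl fun c _ => by ring
  have h3 : ∀ j, ((symMatrix fun z => D (r (j, z))) * Q).trace =
      if j = i then ((Finset.univ.filter fun p : Fin n × Fin n => s(p.1, p.2) = z).card : K) * q z
        else 0 := by
    intro j
    rw [Matrix.trace]
    simp only [Matrix.diag_apply, Matrix.mul_apply, hQ, symMatrix, Matrix.of_apply, hD,
      Prod.mk.injEq]
    split_ifs with hj
    · subst hj
      rw [← nsmul_eq_mul, ← Finset.sum_const, Finset.sum_filter, ← Finset.univ_product_univ,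
        Finset.sum_product]
      refine Finset.sum_congr rfl fun c _ => Finset.sum_congr rfl fun d _ => ?_
      by_cases hcd : s(c, d) = z
      · simp [hcd, ← Sym2.eq_swap (a := c) (b := d)]
      · simp [hcd, Ne.symm hcd]
    · simp [Ne.symm hj]
  have h4 := h.trace_eq_zero
  have h5 := h.trace_mul_eq_zero
  rw [← hQ] at h4 h5
  have h6 : ((Finset.univ.filter fun p : Fin n × Fin n => s(p.1, p.2) = z).card : K) ≠ 0 := by
    rw [Nat.cast_ne_zero, Finset.card_ne_zero]
    induction z with | _ a b => exact ⟨(a, b), by simp⟩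
  simp only [hA', add_mul, Finset.sum_mul, Matrix.trace_add, Matrix.trace_sum, smul_mul_assoc,
    Matrix.trace_smul, one_mul, h3, h4, h5, zero_add, smul_eq_mul, mul_ite,
    mul_zero, Finset.sum_ite_eq', Finset.mem_univ, if_true] at hDA
  exact mul_ne_zero (pow_ne_zero_iff two_ne_zero |>.1 hi)
    (mul_ne_zero h6 (pow_ne_zero_iff two_ne_zero |>.1 hz)) hDA

/-- The pencils that admit a degenerate triple satisfy a nontrivial polynomial equation. -/
theorem exists_ne_zero_forall_isDegenerate_eval_eq_zero (l n : ℕ) :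
    ∃ p : MvPolynomial (Fin l × Sym2 (Fin n)) ℝ, p ≠ 0 ∧
      ∀ r x q, IsDegenerate r x q → MvPolynomial.eval r p = 0 := by
  obtain ⟨p, hp, h⟩ := exists_ne_zero_forall_eval_eq_zero
    (σ := Fin l × Sym2 (Fin n)) (τ := Fin (l + 1) ⊕ Sym2 (Fin n))
    {z | IsDegenerate z.1 (fun i => z.2 (Sum.inl i)) (fun i => z.2 (Sum.inr i))}
    fun K _ _ a v hf hD => (isDegenerate_of_forall_eval_eq_zero fun f h =>
      hf f fun z hz => h z.1 z.2 hz).false_of_derivations hD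
  exact ⟨p, hp, fun r x q hq => h (r, Sum.elim x q) hq⟩

/-! ### Submanifolds in fibres of submersions -/

/-- A fibre of an analytic submersion at a point contains a submanifold of the expected dimension;
only the germ of the fibre at that point matters. -/
theorem containsSubmanifold_of_submersion {m d : ℕ} {G : Type*} [NormedAddCommGroup G]
    [NormedSpace ℝ G] [FiniteDimensional ℝ G] {A : Set (EuclideanSpace ℝ (Fin m))}
    {F : EuclideanSpace ℝ (Fin m) → G} {x₀ : EuclideanSpace ℝ (Fin m)} (hF : ContDiff ℝ ω F)
    (hsurj : Function.Surjective (fderiv ℝ F x₀)) (hx₀ : F x₀ = 0)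
    (hA : ∀ᶠ x in 𝓝 x₀, F x = 0 → x ∈ A) (hd : d + finrank ℝ G = m) :
    ContainsSubmanifold A d := by
  let F' := fderiv ℝ F x₀
  let K := F'.ker
  have hK : finrank ℝ (EuclideanSpace ℝ (Fin d)) = finrank ℝ K := by
    have h1 := F'.toLinearMap.finrank_range_add_finrank_ker
    rw [LinearMap.range_eq_top.2 hsurj, finrank_top, finrank_euclideanSpace_fin] at h1
    rw [finrank_euclideanSpace_fin]
    change finrank ℝ G + finrank ℝ K = m at h1
    omega
  let ι : EuclideanSpace ℝ (Fin d) ≃L[ℝ] K := ContinuousLinearEquiv.ofFinrankEq hK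
  let π : EuclideanSpace ℝ (Fin m) →L[ℝ] EuclideanSpace ℝ (Fin d) :=
    (ι.symm : K →L[ℝ] EuclideanSpace ℝ (Fin d)).comp K.orthogonalProjectionOnto
  let Φ : EuclideanSpace ℝ (Fin m) → G × EuclideanSpace ℝ (Fin d) := fun x => (F x, π x)
  have hΦ : ContDiff ℝ ω Φ := hF.prodMk π.contDiff
  have hinj : Function.Injective (F'.prod π) := by
    rw [injective_iff_map_eq_zero]
    intro x hx
    obtain ⟨h1, h2⟩ := Prod.mk.inj hx
    have h3 : K.orthogonalProjectionOnto x = 0 := by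
      simpa [π] using h2
    have h4 : x ∈ K := h1
    have h5 := K.orthogonalProjectionOnto_mem_subspace_eq_self ⟨x, h4⟩
    rw [h3] at h5
    exact (congrArg Subtype.val h5).symm
  have hfin : finrank ℝ (EuclideanSpace ℝ (Fin m)) =
      finrank ℝ (G × EuclideanSpace ℝ (Fin d)) := by
    rw [finrank_prod, finrank_euclideanSpace_fin, finrank_euclideanSpace_fin]
    omega
  let Φ' : EuclideanSpace ℝ (Fin m) ≃L[ℝ] G × EuclideanSpace ℝ (Fin d) :=
    ContinuousLinearEquiv.ofBijective (F'.prod π) (LinearMap.ker_eq_bot.2 hinj)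
      (LinearMap.range_eq_top.2
        ((LinearMap.injective_iff_surjective_of_finrank_eq_finrank hfin).1 hinj))
  have hΦ' : HasFDerivAt Φ (Φ' : EuclideanSpace ℝ (Fin m) →L[ℝ] _) x₀ := by
    have : (Φ' : EuclideanSpace ℝ (Fin m) →L[ℝ] _) = F'.prod π := by
      ext x <;> rfl
    rw [this]
    exact ((hF.differentiable (by simp)) x₀).hasFDerivAt.prodMk π.hasFDerivAt
  let f := hΦ.contDiffAt.toOpenPartialHomeomorph Φ hΦ' (by simp)
  have hmem : Φ x₀ ∈ f.target := hΦ.contDiffAt.image_mem_toOpenPartialHomeomorph_target hΦ' (by simp)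
  have hsymm : f.symm (Φ x₀) = x₀ :=
    f.left_inv (hΦ.contDiffAt.mem_toOpenPartialHomeomorph_source hΦ' (by simp))
  have hsm : ContDiffAt ℝ ω f.symm (Φ x₀) := by
    refine f.contDiffAt_symm hmem ?_ ?_ (f₀' := Φ')
    · rw [hsymm]; exact hΦ'
    · exact hΦ.contDiffAt
  let j : EuclideanSpace ℝ (Fin d) → G × EuclideanSpace ℝ (Fin d) := fun v => (0, v)
  have hj : ContDiff ℝ ω j := contDiff_const.prodMk contDiff_id
  have hj0 : j (π x₀) = Φ x₀ := by simp [j, Φ, hx₀]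
  have hjt : Tendsto j (𝓝 (π x₀)) (𝓝 (Φ x₀)) := hj0 ▸ hj.continuous.continuousAt
  -- analyticity at one point, unlike `C^∞` at one point, persists in a neighbourhood
  have hev : ∀ᶠ y in 𝓝 (Φ x₀), y ∈ f.target ∧ ContDiffAt ℝ ω f.symm y ∧
      (F (f.symm y) = 0 → f.symm y ∈ A) := by
    refine (f.open_target.eventually_mem hmem).and ((hsm.eventually (by simp)).and ?_)
    have := f.symm.continuousAt hmem
    rw [ContinuousAt, hsymm] at this
    exact this.eventually hA
  obtain ⟨V, hV, hVo, hV0⟩ := eventually_nhds_iff.1 (hjt.eventually hev)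
  have hΦψ : ∀ v ∈ V, Φ (f.symm (j v)) = j v := fun v hv => f.right_inv (hV v hv).1
  have hψ : ∀ v ∈ V, ContDiffAt ℝ ω (fun v => f.symm (j v)) v := fun v hv =>
    (hV v hv).2.1.comp v hj.contDiffAt
  refine ⟨V, fun v => f.symm (j v), hVo, ⟨_, hV0⟩,
    fun v hv => ((hψ v hv).of_le le_top).contDiffWithinAt, fun v hv => ?_, ?_, fun v hv => ?_⟩
  · have h1 : HasFDerivAt (fun v => π (f.symm (j v)))
        (π.comp (fderiv ℝ (fun v => f.symm (j v)) v)) v :=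
      π.hasFDerivAt.comp v ((hψ v hv).differentiableAt (by simp)).hasFDerivAt
    have h2 : HasFDerivAt (fun v => π (f.symm (j v))) (ContinuousLinearMap.id ℝ _) v := by
      refine (hasFDerivAt_id v).congr_of_eventuallyEq ?_
      filter_upwards [hVo.mem_nhds hv] with w hw
      exact congrArg Prod.snd (hΦψ w hw)
    have h3 := h1.unique h2
    exact Function.LeftInverse.injective (g := π) fun w => DFunLike.congr_fun h3 w
  · refine Topology.IsEmbedding.of_comp ?_ π.continuous ?_
    · exact continuous_iff_continuousAt.2 fun v =>
        (hψ v v.2).continuousAt.comp continuousAt_subtype_val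
    · have : (π ∘ fun v : V => f.symm (j v)) = Subtype.val :=
        funext fun v => congrArg Prod.snd (hΦψ v v.2)
      rw [this]
      exact Topology.IsEmbedding.subtypeVal
  · exact (hV v hv).2.2 (congrArg Prod.fst (hΦψ v hv))

/-- A submanifold of a set that is contained, near one point of the submanifold, in a fibre of a
submersion has at most the dimension of the fibre. -/
theorem add_finrank_le_of_immersion {m e : ℕ} {G : Type*} [NormedAddCommGroup G]
    [NormedSpace ℝ G] [FiniteDimensional ℝ G] {F : EuclideanSpace ℝ (Fin m) → G}
    {ψ : EuclideanSpace ℝ (Fin e) → EuclideanSpace ℝ (Fin m)} {v : EuclideanSpace ℝ (Fin e)}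
    (hF : DifferentiableAt ℝ F (ψ v)) (hsurj : Function.Surjective (fderiv ℝ F (ψ v)))
    (hψ : DifferentiableAt ℝ ψ v) (hinj : Function.Injective (fderiv ℝ ψ v))
    (h0 : ∀ᶠ w in 𝓝 v, F (ψ w) = 0) : e + finrank ℝ G ≤ m := by
  have h1 : (fderiv ℝ F (ψ v)).comp (fderiv ℝ ψ v) = 0 :=
    (hF.hasFDerivAt.comp v hψ.hasFDerivAt).unique
      ((hasFDerivAt_const (0 : G) v).congr_of_eventuallyEq h0)
  have h2 := LinearMap.finrank_range_add_finrank_ker (fderiv ℝ F (ψ v)).toLinearMap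
  rw [LinearMap.range_eq_top.2 hsurj, finrank_top, finrank_euclideanSpace_fin] at h2
  have h3 := LinearMap.finrank_range_of_inj (f := (fderiv ℝ ψ v).toLinearMap) hinj
  rw [finrank_euclideanSpace_fin] at h3
  have h4 : (fderiv ℝ ψ v).toLinearMap.range ≤ (fderiv ℝ F (ψ v)).toLinearMap.ker := by
    rintro _ ⟨w, rfl⟩
    exact DFunLike.congr_fun h1 w
  have h5 := Submodule.finrank_mono h4
  omega

/-! ### Corank and semidefiniteness in terms of the characteristic polynomial -/

open Polynomial in
theorem prod_X_add_C_eq_X_pow_mul {ι : Type*} (s : Finset ι) (c : ι → ℝ) :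
    ∏ i ∈ s, (X + C (c i)) =
      X ^ (s.filter fun i => c i = 0).card * ∏ i ∈ s.filter fun i => c i ≠ 0, (X + C (c i)) := by
  rw [← Finset.prod_filter_mul_prod_filter_not s (fun i => c i = 0)]
  congr 1
  rw [← Finset.prod_const]
  exact Finset.prod_congr rfl fun i hi => by simp [(Finset.mem_filter.1 hi).2]

open Polynomial in
theorem coeff_prod_X_add_C_pos {ι : Type*} (s : Finset ι) (c : ι → ℝ) (hc : ∀ i ∈ s, 0 < c i)
    {j : ℕ} (hj : j ≤ s.card) : 0 < (∏ i ∈ s, (X + C (c i))).coeff j := by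
  classical
  induction s using Finset.induction_on generalizing j with
  | empty =>
    obtain rfl : j = 0 := by simpa using hj
    simp
  | insert a s ha ih =>
    have hs : ∀ i ∈ s, 0 < c i := fun i hi => hc i (Finset.mem_insert_of_mem hi)
    have h0 : ∀ i, 0 ≤ (∏ i ∈ s, (X + C (c i))).coeff i := fun i => by
      by_cases hi : i ≤ s.card
      · exact (ih hs hi).le
      · rw [coeff_eq_zero_of_natDegree_lt]
        rw [natDegree_prod_of_monic _ _ fun i _ => monic_X_add_C _]
        simpa using hi
    have hca := hc a (Finset.mem_insert_self a s)
    rw [Finset.card_insert_of_notMem ha] at hj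
    rw [Finset.prod_insert ha, add_mul]
    cases j with
    | zero => simpa using mul_pos hca (ih hs (Nat.zero_le _))
    | succ j =>
      rw [coeff_add, coeff_X_mul, coeff_C_mul]
      exact add_pos_of_pos_of_nonneg (ih hs (by omega)) (mul_nonneg hca.le (h0 _))

namespace Matrix

variable {n : ℕ} {M : Matrix (Fin n) (Fin n) ℝ}

/-- The eigenvalues `c` of a symmetric matrix `M`, read off from `(-M).charpoly = det (X + M)`. -/
theorem IsSymm.exists_charpoly_neg_eq (hM : M.IsSymm) :
    ∃ c : Fin n → ℝ, (-M).charpoly = ∏ i, (Polynomial.X + Polynomial.C (c i)) ∧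
      M.rank + (Finset.univ.filter fun i => c i = 0).card = n ∧
      (M.PosSemidef ↔ ∀ i, 0 ≤ c i) := by
  have hM' : M.IsHermitian := by
    rw [IsHermitian, conjTranspose_eq_transpose_of_trivial]; exact hM
  have h := hM'.neg
  refine ⟨fun i => -h.eigenvalues i, ?_, ?_, ?_⟩
  · rw [h.charpoly_eq]
    exact Finset.prod_congr rfl fun i _ => by simp [sub_eq_add_neg]
  · have h1 : M.rank = (-M).rank := by
      have := rank_smul_of_mem_nonZeroDivisors M
        (c := (-1 : ℝ)) (mem_nonZeroDivisors_of_ne_zero (by norm_num))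
      rw [← this, neg_one_smul]
    rw [h1, h.rank_eq_card_non_zero_eigs, Fintype.card_subtype, add_comm]
    simp only [neg_eq_zero]
    rw [Finset.card_filter_add_card_filter_not, Finset.card_univ, Fintype.card_fin]
  · have h2 : M = (h.eigenvectorUnitary : Matrix _ _ ℝ) *
        diagonal (fun i => -h.eigenvalues i) * star (h.eigenvectorUnitary : Matrix _ _ ℝ) := by
      have h3 := h.spectral_theorem
      rw [Unitary.conjStarAlgAut_apply] at h3
      have h4 : diagonal (fun i => -h.eigenvalues i) = - diagonal h.eigenvalues := by
        rw [diagonal_neg]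
      rw [h4, mul_neg, neg_mul, eq_neg_iff_add_eq_zero, ← eq_neg_iff_add_eq_zero, ← neg_eq_iff_eq_neg]
      exact h3
    conv_lhs => rw [h2]
    exact (IsUnit.posSemidef_star_right_conjugate_iff
      (Unitary.toUnits h.eigenvectorUnitary).isUnit).trans posSemidef_diagonal_iff

/-- The corank of a symmetric matrix is the order of vanishing of its characteristic polynomial
at `0`. -/
theorem IsSymm.rank_add_eq_iff (hM : M.IsSymm) (k : ℕ) :
    M.rank + k = n ↔ (∀ j < k, (-M).charpoly.coeff j = 0) ∧ (-M).charpoly.coeff k ≠ 0 := by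
  obtain ⟨c, h1, h2, -⟩ := hM.exists_charpoly_neg_eq
  set m := (Finset.univ.filter fun i => c i = 0).card
  have h3 : ∀ j, (-M).charpoly.coeff j = if m ≤ j then
      (∏ i with c i ≠ 0, (Polynomial.X + Polynomial.C (c i))).coeff (j - m) else 0 := fun j => by
    rw [h1, prod_X_add_C_eq_X_pow_mul, Polynomial.coeff_X_pow_mul']
  have h4 : (-M).charpoly.coeff m ≠ 0 := by
    rw [h3, if_pos le_rfl, Nat.sub_self, Polynomial.coeff_zero_prod]
    refine Finset.prod_ne_zero_iff.2 fun i hi => ?_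
    simpa using hi
  have h5 : ∀ j < m, (-M).charpoly.coeff j = 0 := fun j hj => by
    rw [h3, if_neg (by omega)]
  constructor
  · intro h
    obtain rfl : k = m := by omega
    exact ⟨h5, h4⟩
  · rintro ⟨h6, h7⟩
    have : k = m := by
      rcases lt_trichotomy k m with h | h | h
      · exact absurd (h5 k h) h7
      · exact h
      · exact absurd (h6 m h) h4
    omega

theorem PosSemidef.charpoly_neg_coeff_pos (hM : M.IsSymm) (hp : M.PosSemidef) {j k : ℕ}
    (hk : M.rank + k = n) (hkj : k ≤ j) (hj : j ≤ n) : 0 < (-M).charpoly.coeff j := by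
  obtain ⟨c, h1, h2, h3⟩ := hM.exists_charpoly_neg_eq
  have h5 := Finset.card_filter_add_card_filter_not (s := Finset.univ) (fun i : Fin n => c i = 0)
  rw [Finset.card_univ, Fintype.card_fin] at h5
  rw [h1, prod_X_add_C_eq_X_pow_mul, Polynomial.coeff_X_pow_mul', if_pos (by omega)]
  refine coeff_prod_X_add_C_pos _ _ (fun i hi => ?_) (by simp only [ne_eq]; omega)
  exact lt_of_le_of_ne (h3.1 hp i) (Finset.mem_filter.1 hi).2.symm

theorem IsSymm.posSemidef_of_charpoly_neg_coeff_nonneg (hM : M.IsSymm)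
    (h : ∀ j, 0 ≤ (-M).charpoly.coeff j) : M.PosSemidef := by
  obtain ⟨c, h1, -, h3⟩ := hM.exists_charpoly_neg_eq
  refine h3.2 fun i => ?_
  by_contra! hi
  have h4 : (-M).charpoly.eval (-c i) = 0 := by
    rw [h1, Polynomial.eval_prod]
    exact Finset.prod_eq_zero (Finset.mem_univ i) (by simp)
  rw [Polynomial.eval_eq_sum_range, charpoly_natDegree_eq_dim, Fintype.card_fin] at h4
  have h5 := Finset.single_le_sum (s := Finset.range (n + 1))
    (f := fun j => (-M).charpoly.coeff j * (-c i) ^ j)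
    (fun j _ => mul_nonneg (h j) (pow_nonneg (by linarith) j)) (Finset.self_mem_range_succ n)
  have h6 : (-M).charpoly.coeff n = 1 := by
    have := charpoly_monic (-M)
    rwa [Polynomial.Monic, Polynomial.leadingCoeff, charpoly_natDegree_eq_dim,
      Fintype.card_fin] at this
  simp only [h4, h6, one_mul] at h5
  have : 0 < (-c i) ^ n := pow_pos (by linarith) n
  linarith

theorem IsSymm.posSemidef_iff_charpoly_neg_coeff_nonneg (hM : M.IsSymm) :
    M.PosSemidef ↔ ∀ j ∈ Finset.range (n + 1), 0 ≤ (-M).charpoly.coeff j := by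
  constructor
  · intro hp j hj
    obtain ⟨c, -, h2, -⟩ := hM.exists_charpoly_neg_eq
    by_cases hk : (Finset.univ.filter fun i => c i = 0).card ≤ j
    · exact (hp.charpoly_neg_coeff_pos hM h2 hk (Nat.lt_succ_iff.1 (Finset.mem_range.1 hj))).le
    · exact (((hM.rank_add_eq_iff _).1 h2).1 j (not_le.1 hk)).ge
  · refine fun h => hM.posSemidef_of_charpoly_neg_coeff_nonneg fun j => ?_
    by_cases hj : j ∈ Finset.range (n + 1)
    · exact h j hj
    · rw [Polynomial.coeff_eq_zero_of_natDegree_lt]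
      rw [charpoly_natDegree_eq_dim, Fintype.card_fin]
      simpa using hj

end Matrix

/-! ### Generic transversality -/

/-- The pencil of `R` meets the rank strata of symmetric matrices transversally: at no unit vector
`x` is there a nonzero conormal vector `Q` of the stratum of `pencil R x` that is orthogonal to the
whole pencil. -/
def IsTransversal {l n : ℕ} (R : Fin l → SymMat n) : Prop :=
  ∀ x ∈ unitSphere l, ∀ Q : Matrix (Fin n) (Fin n) ℝ, Q.IsSymm → pencil R x * Q = 0 →
    (∀ y, (pencil R y * Q).trace = 0) → Q = 0

theorem Matrix.IsSymm.apply_out {ι S : Type*} {M : Matrix ι ι S} (hM : M.IsSymm) (a b : ι) : M (Quot.out s(a, b)).1 (Quot.out s(a, b)).2 = M a b := by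
  have h : s((Quot.out s(a, b)).1, (Quot.out s(a, b)).2) = s(a, b) := Quot.out_eq s(a, b)
  rcases Sym2.eq_iff.1 h with ⟨h1, h2⟩ | ⟨h1, h2⟩
  · rw [h1, h2]
  · rw [h1, h2, hM.apply]

theorem Matrix.IsSymm.symMatrix_out {n : ℕ} {S : Type*} {M : Matrix (Fin n) (Fin n) S}
    (hM : M.IsSymm) : (symMatrix fun z => M (Quot.out z).1 (Quot.out z).2) = M :=
  Matrix.ext hM.apply_out

theorem symPencil_out {l n : ℕ} (R : Fin l → SymMat n) (x : EuclideanSpace ℝ (Fin (l + 1))) :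
    (symPencil (fun t => (R t.1).1 (Quot.out t.2).1 (Quot.out t.2).2) fun i => x i) =
      pencil R x := by
  simp only [symPencil, pencil, (R _).2.symMatrix_out]

theorem symPencil_const_mul {l n : ℕ} (r : Fin l × Sym2 (Fin n) → ℝ) (x : Fin (l + 1) → ℝ)
    (c : ℝ) : (symPencil r fun i => c * x i) = c • symPencil r x := by
  simp only [symPencil, mul_smul, smul_add, Finset.smul_sum]

theorem symMatrix_const_mul {n : ℕ} (q : Sym2 (Fin n) → ℝ) (c : ℝ) :
    (symMatrix fun z => c * q z) = c • symMatrix q := rfl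

theorem pencil_single_zero {l n : ℕ} (R : Fin l → SymMat n) :
    pencil R (EuclideanSpace.single 0 1) = 1 := by
  simp [pencil]

theorem pencil_single_succ {l n : ℕ} (R : Fin l → SymMat n) (i : Fin l) :
    pencil R (EuclideanSpace.single i.succ 1) = (R i).1 := by
  rw [pencil, Finset.sum_eq_single i]
  · simp [(Fin.succ_ne_zero i).symm]
  · intro j _ hj
    simp [hj]
  · simp

theorem exists_isDegenerate_of_not_isTransversal {l n : ℕ} {R : Fin l → SymMat n}
    (hR : ¬ IsTransversal R) :
    ∃ x q, IsDegenerate (fun t => (R t.1).1 (Quot.out t.2).1 (Quot.out t.2).2) x q := by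
  simp only [IsTransversal, not_forall] at hR
  obtain ⟨x, hx, Q, hQ, hmul, htr, hne⟩ := hR
  have hs : ∑ i : Fin l, x i.succ ^ 2 ≠ 0 := by
    intro h0
    have h1 : ∀ i : Fin l, x i.succ = 0 := fun i => by
      simpa using (Finset.sum_eq_zero_iff_of_nonneg fun i _ => sq_nonneg _).1 h0 i
        (Finset.mem_univ i)
    have h2 : x 0 ≠ 0 := by
      intro h3
      have : x = 0 := by
        ext i
        refine Fin.cases h3 h1 i
      rw [unitSphere, this] at hx
      simp at hx
    apply hne
    simpa [pencil, h1, h2] using hmul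
  let q : Sym2 (Fin n) → ℝ := fun z => Q (Quot.out z).1 (Quot.out z).2
  have hq : symMatrix q = Q := hQ.symMatrix_out
  have hs' : ∑ z, q z ^ 2 ≠ 0 := by
    intro h0
    apply hne
    rw [← hq]
    ext a b
    exact pow_eq_zero_iff two_ne_zero |>.1 <|
      (Finset.sum_eq_zero_iff_of_nonneg fun i _ => sq_nonneg _).1 h0 s(a, b) (Finset.mem_univ _)
  have key : ∀ s : ℝ, 0 ≤ s → s ≠ 0 → (√s)⁻¹ ^ 2 * s = 1 := fun s h1 h2 => by
    rw [inv_pow, Real.sq_sqrt h1, inv_mul_cancel₀ h2]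
  refine ⟨fun i => (√(∑ i : Fin l, x i.succ ^ 2))⁻¹ * x i, fun z => (√(∑ z, q z ^ 2))⁻¹ * q z,
    fun a b => ?_, ?_, fun i => ?_, ?_, ?_⟩
  · rw [symPencil_const_mul, symMatrix_const_mul, symPencil_out, hq]
    simp [hmul]
  · rw [symMatrix_const_mul, hq, Matrix.trace_smul]
    have := htr (EuclideanSpace.single 0 1)
    rw [pencil_single_zero, one_mul] at this
    rw [this, smul_zero]
  · rw [symMatrix_const_mul, hq, (R i).2.symMatrix_out, mul_smul_comm, Matrix.trace_smul,
      ← pencil_single_succ, htr, smul_zero]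
  · simp only [mul_pow]
    rw [← Finset.mul_sum, key _ (Finset.sum_nonneg fun _ _ => sq_nonneg _) hs]
  · simp only [mul_pow]
    rw [← Finset.mul_sum, key _ (Finset.sum_nonneg fun _ _ => sq_nonneg _) hs']

theorem forGenericTuple_isTransversal (l n : ℕ) :
    ForGenericTuple (fun R : Fin l → SymMat n => IsTransversal R) := by
  obtain ⟨p, hp, h⟩ := exists_ne_zero_forall_isDegenerate_eval_eq_zero l n
  have heval : ∀ R : Fin l → SymMat n, MvPolynomial.eval (fun t => (R t.1).1 t.2.1 t.2.2)
      (MvPolynomial.rename (fun t : Fin l × Sym2 (Fin n) => (t.1, Quot.out t.2)) p) =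
      MvPolynomial.eval (fun t => (R t.1).1 (Quot.out t.2).1 (Quot.out t.2).2) p := fun R => by
    rw [MvPolynomial.eval_rename]
    rfl
  refine ⟨MvPolynomial.rename (fun t => (t.1, Quot.out t.2)) p, ?_, fun R hR => ?_⟩
  · by_contra! h0
    refine hp (MvPolynomial.funext fun r => ?_)
    let R : Fin l → SymMat n := fun t => ⟨symMatrix fun z => r (t, z), symMatrix_transpose _⟩
    rw [map_zero, ← (heval R).symm.trans (h0 R)]
    refine congrArg (fun g => MvPolynomial.eval g p) (funext fun t => ?_)
    exact congrArg (fun z => r (t.1, z)) (Quot.out_eq t.2).symm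
  · by_contra hT
    obtain ⟨x, q, hd⟩ := exists_isDegenerate_of_not_isTransversal hT
    exact hR ((heval R).trans (h _ x q hd))

/-! ### Local equations of the rank strata -/

namespace Matrix

/-- A matrix with an invertible upper left block `A` has the rank of `A` iff its Schur complement,
here multiplied by `A.det`, vanishes. -/
theorem rank_fromBlocks_eq_card_iff {ν κ : Type*} [Fintype ν] [DecidableEq ν] [Fintype κ]
    [DecidableEq κ] {A : Matrix ν ν ℝ} {B : Matrix ν κ ℝ} {C : Matrix κ ν ℝ} {D : Matrix κ κ ℝ}
    (hA : A.det ≠ 0) :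
    (fromBlocks A B C D).rank = Fintype.card ν ↔ A.det • D - C * A.adjugate * B = 0 := by
  let _ : Invertible A := invertibleOfIsUnitDet A (isUnit_iff_ne_zero.2 hA)
  have h1 : A.det • (D - C * ⅟A * B) = A.det • D - C * A.adjugate * B := by
    rw [smul_sub, invOf_eq_nonsing_inv, inv_def, Ring.inverse_eq_inv', Matrix.mul_smul,
      Matrix.smul_mul, smul_smul, mul_inv_cancel₀ hA, one_smul]
  set S := D - C * ⅟A * B with hS
  have h2 : (fromBlocks A B C D).rank = (fromBlocks (1 : Matrix ν ν ℝ) 0 0 S).rank := by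
    have h3 : fromBlocks A (0 : Matrix ν κ ℝ) 0 S =
        fromBlocks A 0 0 1 * fromBlocks 1 0 0 S := by
      simp [fromBlocks_multiply]
    rw [fromBlocks_eq_of_invertible₁₁ A B C D, rank_mul_eq_left_of_isUnit_det,
      rank_mul_eq_right_of_isUnit_det, ← hS, h3, rank_mul_eq_right_of_isUnit_det]
    · simpa using hA
    · simp
    · simp
  rw [← h1, smul_eq_zero, or_iff_right hA, h2]
  constructor
  · intro h
    ext i j
    by_contra hij
    have h4 := rank_submatrix_le (fromBlocks (1 : Matrix ν ν ℝ) 0 0 S)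
      (Sum.map id fun _ : Unit => i) (Sum.map id fun _ : Unit => j)
    have h5 : (fromBlocks (1 : Matrix ν ν ℝ) 0 0 S).submatrix
        (Sum.map id fun _ : Unit => i) (Sum.map id fun _ : Unit => j) =
        fromBlocks 1 0 0 (of fun _ _ => S i j) := by
      ext (a | a) (b | b) <;> rfl
    rw [h5, h, rank_of_det_ne_zero] at h4
    · simp at h4
    · simpa using hij
  · intro h
    have : fromBlocks (1 : Matrix ν ν ℝ) 0 0 S = diagonal (Sum.elim 1 0 : ν ⊕ κ → ℝ) := by
      rw [h, ← fromBlocks_diagonal]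
      simp
    rw [this, rank_diagonal, Fintype.card_subtype]
    simp [Finset.card_filter, Fintype.sum_sum_type]

theorem contDiff_det {E ν : Type*} [NormedAddCommGroup E] [NormedSpace ℝ E] [Fintype ν]
    [DecidableEq ν] {A : E → Matrix ν ν ℝ} (hA : ∀ i j, ContDiff ℝ ω fun x => A x i j) :
    ContDiff ℝ ω fun x => (A x).det := by
  simp only [det_apply]
  exact ContDiff.sum fun σ _ => (contDiff_prod fun i _ => hA _ _).const_smul _

theorem contDiff_adjugate {E ν : Type*} [NormedAddCommGroup E] [NormedSpace ℝ E] [Fintype ν]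
    [DecidableEq ν] {A : E → Matrix ν ν ℝ} (hA : ∀ i j, ContDiff ℝ ω fun x => A x i j) (i j : ν) :
    ContDiff ℝ ω fun x => (A x).adjugate i j := by
  simp only [adjugate_apply]
  refine contDiff_det fun a b => ?_
  simp only [updateRow_apply]
  split_ifs
  · exact contDiff_const
  · exact hA a b

end Matrix

/-- If no nonzero symmetric matrix is orthogonal to all members of a linear family of symmetric
matrices, then the family consists of all symmetric matrices. -/
theorem surjective_apply_out_of_forall_trace_mul_eq_zero {E κ : Type*} [AddCommGroup E]
    [Module ℝ E] [Fintype κ] [DecidableEq κ] (N : E →ₗ[ℝ] Matrix κ κ ℝ) (hN : ∀ y, (N y).IsSymm)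
    (h : ∀ Q : Matrix κ κ ℝ, Q.IsSymm → (∀ y, (N y * Q).trace = 0) → Q = 0) (w : Sym2 κ → ℝ) :
    ∃ y, ∀ z, N y (Quot.out z).1 (Quot.out z).2 = w z := by
  let L : E →ₗ[ℝ] Sym2 κ → ℝ :=
    LinearMap.pi fun z => (Matrix.entryLinearMap ℝ ℝ (Quot.out z).1 (Quot.out z).2).comp N
  suffices hL : LinearMap.range L = ⊤ by
    obtain ⟨y, hy⟩ := LinearMap.range_eq_top.1 hL w
    exact ⟨y, fun z => congrFun hy z⟩
  by_contra hL
  obtain ⟨f, hf, hle⟩ := Submodule.exists_le_ker_of_lt_top _ (lt_top_iff_ne_top.2 hL)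
  apply hf
  -- the weight `μ` compensates that off-diagonal pairs occur twice in a trace
  let μ : Sym2 κ → ℝ := fun z => ((Finset.univ.filter fun p : κ × κ => s(p.1, p.2) = z).card : ℝ)
  have hμ : ∀ z, μ z ≠ 0 := fun z => by
    rw [Nat.cast_ne_zero, Finset.card_ne_zero]
    induction z with | _ a b => exact ⟨(a, b), by simp⟩
  have h1 := h (Matrix.of fun a b => f (Pi.single s(a, b) 1) / μ s(a, b))
    (by ext a b; simp [Sym2.eq_swap]) fun y => by
      have h2 : f (L y) = 0 := hle ⟨y, rfl⟩
      rw [LinearMap.pi_apply_eq_sum_univ] at h2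
      rw [← h2, Matrix.trace]
      simp only [Matrix.diag_apply, Matrix.mul_apply, Matrix.of_apply]
      have h3 : ∀ a b, N y a b * (f (Pi.single s(b, a) 1) / μ s(b, a)) =
          L y s(a, b) * (f (Pi.single s(a, b) 1) / μ s(a, b)) := fun a b => by
        rw [Sym2.eq_swap, ← (hN y).apply_out a b]
        rfl
      simp only [h3]
      rw [← Fintype.sum_prod_type' (f := fun a b =>
          L y s(a, b) * (f (Pi.single s(a, b) 1) / μ s(a, b))),
        ← Finset.sum_fiberwise' Finset.univ (fun p : κ × κ => s(p.1, p.2))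
          (fun z => L y z * (f (Pi.single z 1) / μ z))]
      refine Finset.sum_congr rfl fun z _ => ?_
      rw [Finset.sum_const, nsmul_eq_mul, smul_eq_mul]
      have h4 : (Pi.single z 1 : Sym2 κ → ℝ) = fun j => if z = j then 1 else 0 := by
        ext j
        simp [Pi.single_apply, eq_comm]
      rw [← h4]
      change μ z * _ = _
      field_simp [hμ z]
  refine LinearMap.pi_ext' fun z => LinearMap.ext_ring ?_
  induction z with | _ a b =>
  have h5 := congrFun (congrFun h1 a) b
  simpa [hμ] using h5

/-- Near a point where a linear family of symmetric matrices is block diagonal with blocks `Δ` and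
`0`, `Δ` invertible, its members of minimal rank are the zeros of the Schur complement (multiplied
by a determinant to be polynomial), whose derivative is, up to a factor, the lower right block. -/
theorem exists_equations_rank_eq {E ν κ : Type*} [NormedAddCommGroup E] [NormedSpace ℝ E]
    [FiniteDimensional ℝ E] [Fintype ν] [DecidableEq ν] [Fintype κ] [DecidableEq κ]
    (N : E →ₗ[ℝ] Matrix (ν ⊕ κ) (ν ⊕ κ) ℝ) (hN : ∀ y, (N y).IsSymm) {x₀ : E} {Δ : Matrix ν ν ℝ}
    (hΔ : Δ.det ≠ 0) (hx₀ : N x₀ = Matrix.fromBlocks Δ 0 0 0) :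
    ∃ (F : E → Sym2 κ → ℝ) (F' : E →L[ℝ] Sym2 κ → ℝ), ContDiff ℝ ω F ∧ HasFDerivAt F F' x₀ ∧
      (∀ y z, F' y z = Δ.det * (N y).toBlocks₂₂ (Quot.out z).1 (Quot.out z).2) ∧
      ∀ᶠ x in 𝓝 x₀, F x = 0 ↔ (N x).rank = Fintype.card ν := by
  let ent : (ν ⊕ κ) → (ν ⊕ κ) → E →L[ℝ] ℝ := fun i j =>
    LinearMap.toContinuousLinearMap ((Matrix.entryLinearMap ℝ ℝ i j).comp N)
  have hent : ∀ i j x, N x i j = ent i j x := fun i j x => rfl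
  have hsm : ∀ i j, ContDiff ℝ ω fun x => N x i j := fun i j => (ent i j).contDiff
  have hder : ∀ i j, HasFDerivAt (fun x => N x i j) (ent i j) x₀ := fun i j =>
    (ent i j).hasFDerivAt
  let S : E → Matrix κ κ ℝ := fun x => (N x).toBlocks₁₁.det • (N x).toBlocks₂₂ -
    (N x).toBlocks₂₁ * (N x).toBlocks₁₁.adjugate * (N x).toBlocks₁₂
  have hdet : ContDiff ℝ ω fun x => (N x).toBlocks₁₁.det :=
    Matrix.contDiff_det fun i j => hsm _ _
  have hadj : ∀ i j, ContDiff ℝ ω fun x => (N x).toBlocks₁₁.adjugate i j :=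
    Matrix.contDiff_adjugate fun i j => hsm _ _
  have hS : ∀ x a b, S x a b = (N x).toBlocks₁₁.det * N x (Sum.inr a) (Sum.inr b) -
      ∑ d, (∑ c, N x (Sum.inr a) (Sum.inl c) * (N x).toBlocks₁₁.adjugate c d) *
        N x (Sum.inl d) (Sum.inr b) := fun x a b => by
    simp [S, Matrix.sub_apply, Matrix.mul_apply, Matrix.toBlocks₂₁, Matrix.toBlocks₁₂,
      Matrix.toBlocks₂₂]
  have hSsymm : ∀ x, (S x).IsSymm := fun x => by
    have h1 : (N x).toBlocks₁₁.transpose = (N x).toBlocks₁₁ := by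
      ext i j; exact (hN x).apply _ _
    have h2 : (N x).toBlocks₂₂.transpose = (N x).toBlocks₂₂ := by
      ext i j; exact (hN x).apply _ _
    have h3 : (N x).toBlocks₁₂.transpose = (N x).toBlocks₂₁ := by
      ext i j; exact (hN x).apply _ _
    have h4 : (N x).toBlocks₂₁.transpose = (N x).toBlocks₁₂ := by
      ext i j; exact (hN x).apply _ _
    simp only [S, Matrix.IsSymm, Matrix.transpose_sub, Matrix.transpose_smul,
      Matrix.transpose_mul, Matrix.adjugate_transpose, h1, h2, h3, h4, Matrix.mul_assoc]
  have hSder : ∀ a b, HasFDerivAt (fun x => S x a b) (Δ.det • ent (Sum.inr a) (Sum.inr b)) x₀ := by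
    intro a b
    simp only [hS]
    have h1 := ((hdet.differentiable (by simp)) x₀).hasFDerivAt.mul (hder (Sum.inr a) (Sum.inr b))
    have h2 := fun d => (HasFDerivAt.fun_sum (u := Finset.univ) fun c _ =>
      (hder (Sum.inr a) (Sum.inl c)).mul
        (((hadj c d).differentiable (by simp)) x₀).hasFDerivAt).mul (hder (Sum.inl d) (Sum.inr b))
    refine (h1.sub (HasFDerivAt.fun_sum (u := Finset.univ) fun d _ => h2 d)).congr_fderiv ?_
    simp [hx₀]
  refine ⟨fun x z => S x (Quot.out z).1 (Quot.out z).2,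
    ContinuousLinearMap.pi fun z => Δ.det • ent (Sum.inr (Quot.out z).1) (Sum.inr (Quot.out z).2),
    contDiff_pi.2 fun z => ?_, hasFDerivAt_pi.2 fun z => hSder _ _, fun y z => rfl, ?_⟩
  · rw [show (fun x => S x (Quot.out z).1 (Quot.out z).2) = _ from funext fun x => hS x _ _]
    exact (hdet.mul (hsm _ _)).sub (ContDiff.sum fun d _ =>
      (ContDiff.sum fun c _ => (hsm _ _).mul (hadj _ _)).mul (hsm _ _))
  · have h1 : ∀ᶠ x in 𝓝 x₀, (N x).toBlocks₁₁.det ≠ 0 := by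
      refine hdet.continuous.continuousAt.eventually_ne ?_
      simpa [hx₀] using hΔ
    filter_upwards [h1] with x hx
    conv_rhs => rw [← Matrix.fromBlocks_toBlocks (N x)]
    rw [Matrix.rank_fromBlocks_eq_card_iff hx]
    change _ ↔ S x = 0
    constructor
    · intro h
      ext a b
      rw [← (hSsymm x).apply_out a b]
      exact congrFun h s(a, b)
    · intro h
      ext z
      change S x _ _ = 0
      rw [h]
      rfl

theorem pencil_isSymm {l n : ℕ} (R : Fin l → SymMat n) (x : EuclideanSpace ℝ (Fin (l + 1))) :
    (pencil R x).IsSymm := by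
  rw [← symPencil_out]
  exact symPencil_transpose _ _

/-- The pencil as a linear map in the coefficients. -/
noncomputable def pencilLinearMap {l n : ℕ} (R : Fin l → SymMat n) :
    EuclideanSpace ℝ (Fin (l + 1)) →ₗ[ℝ] Matrix (Fin n) (Fin n) ℝ where
  toFun := pencil R
  map_add' x y := by
    simp only [pencil, PiLp.add_apply, add_smul, Finset.sum_add_distrib]
    abel
  map_smul' c x := by
    simp only [pencil, PiLp.smul_apply, smul_eq_mul, mul_smul, smul_add, Finset.smul_sum,
      RingHom.id_apply]

/-- Near each of its points the corank locus of a transversal pencil is a fibre of a submersion to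
a space of dimension `(k + 1).choose 2 + 1`; the additional coordinate is the equation of the
sphere. -/
theorem exists_equations_corankLocus {l n k : ℕ} {R : Fin l → SymMat n} (hR : IsTransversal R)
    {x₀ : EuclideanSpace ℝ (Fin (l + 1))} (hx₀ : x₀ ∈ corankLocus R k) :
    ∃ (ι : Type) (_ : Fintype ι) (F : EuclideanSpace ℝ (Fin (l + 1)) → (ι → ℝ) × ℝ),
      Fintype.card ι = (k + 1).choose 2 ∧ ContDiff ℝ ω F ∧
      Function.Surjective (fderiv ℝ F x₀) ∧ ∀ᶠ x in 𝓝 x₀, F x = 0 ↔ x ∈ corankLocus R k := by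
  obtain ⟨hs, hk⟩ := hx₀
  have hH : (pencil R x₀).IsHermitian := by
    rw [Matrix.IsHermitian, Matrix.conjTranspose_eq_transpose_of_trivial]
    exact pencil_isSymm R x₀
  set U : Matrix (Fin n) (Fin n) ℝ := (hH.eigenvectorUnitary : Matrix (Fin n) (Fin n) ℝ)
  let c := hH.eigenvalues
  have hdiag : U.transpose * pencil R x₀ * U = Matrix.diagonal c := by
    have h1 := hH.conjStarAlgAut_star_eigenvectorUnitary
    rw [Unitary.conjStarAlgAut_star_apply] at h1
    exact h1
  have hUU : U.transpose * U = 1 := Unitary.coe_star_mul_self hH.eigenvectorUnitary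
  have hUU' : U * U.transpose = 1 := Unitary.coe_mul_star_self hH.eigenvectorUnitary
  let p : Fin n → Prop := fun i => c i ≠ 0
  let e : {i // p i} ⊕ {i // ¬ p i} ≃ Fin n := Equiv.sumCompl p
  have hcard : Fintype.card {i // p i} = (pencil R x₀).rank := hH.rank_eq_card_non_zero_eigs.symm
  have hcard' : Fintype.card {i // ¬ p i} = k := by
    have h1 := Fintype.card_congr e
    rw [Fintype.card_sum, Fintype.card_fin] at h1
    omega
  let N : EuclideanSpace ℝ (Fin (l + 1)) →ₗ[ℝ]
      Matrix ({i // p i} ⊕ {i // ¬ p i}) ({i // p i} ⊕ {i // ¬ p i}) ℝ :=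
    { toFun := fun y => (U.transpose * pencil R y * U).submatrix e e
      map_add' := fun x y => by
        have : pencil R (x + y) = pencil R x + pencil R y := (pencilLinearMap R).map_add x y
        rw [this, mul_add, add_mul]
        rfl
      map_smul' := fun a y => by
        have : pencil R (a • y) = a • pencil R y := (pencilLinearMap R).map_smul a y
        rw [this, mul_smul_comm, smul_mul_assoc]
        rfl }
  have hNdef : ∀ y, N y = (U.transpose * pencil R y * U).submatrix e e := fun y => rfl
  have hN : ∀ y, (N y).IsSymm := fun y => by
    rw [hNdef, Matrix.IsSymm, Matrix.transpose_submatrix, Matrix.transpose_mul,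
      Matrix.transpose_mul, Matrix.transpose_transpose, (pencil_isSymm R y).eq, mul_assoc]
  have hNrank : ∀ y, (N y).rank = (pencil R y).rank := fun y => by
    rw [hNdef, Matrix.rank_submatrix, Matrix.rank_mul_eq_left_of_isUnit_det,
      Matrix.rank_mul_eq_right_of_isUnit_det]
    · exact (Matrix.isUnit_iff_isUnit_det _).1 (IsUnit.of_mul_eq_one _ hUU)
    · exact (Matrix.isUnit_iff_isUnit_det _).1 (IsUnit.of_mul_eq_one _ hUU')
  have hNx₀ : N x₀ = Matrix.fromBlocks (Matrix.diagonal fun i : {i // p i} => c i) 0 0 0 := by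
    rw [hNdef, hdiag]
    ext (i | i) (j | j)
    · simp [e, Matrix.diagonal_apply, Subtype.ext_iff]
    · have : (i : Fin n) ≠ j := fun h => j.2 (h ▸ i.2)
      simp [e, this]
    · have : (i : Fin n) ≠ j := fun h => i.2 (h ▸ j.2)
      simp [e, this]
    · have h1 : c i = 0 := not_not.1 i.2
      simp [e, Matrix.diagonal_apply, h1]
  have hdet : (Matrix.diagonal fun i : {i // p i} => c i).det ≠ 0 := by
    rw [Matrix.det_diagonal]
    exact Finset.prod_ne_zero_iff.2 fun i _ => i.2
  obtain ⟨F, F', hF, hF', hF'eq, hev⟩ := exists_equations_rank_eq N hN hdet hNx₀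
  -- transversality of the pencil gives surjectivity of the lower right block
  let N₂₂ : EuclideanSpace ℝ (Fin (l + 1)) →ₗ[ℝ] Matrix {i // ¬ p i} {i // ¬ p i} ℝ :=
    { toFun := fun y => (N y).toBlocks₂₂
      map_add' := fun x y => by rw [map_add]; rfl
      map_smul' := fun a y => by rw [map_smul]; rfl }
  have hsurj := surjective_apply_out_of_forall_trace_mul_eq_zero N₂₂
    (fun y => Matrix.ext fun i j => (hN y).apply _ _) fun Q hQ htr => by
      let Q' : Matrix (Fin n) (Fin n) ℝ := (Matrix.fromBlocks 0 0 0 Q).submatrix e.symm e.symm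
      have hQ' : ∀ M : Matrix (Fin n) (Fin n) ℝ,
          M * Q' = ((M.submatrix e e) * Matrix.fromBlocks 0 0 0 Q).submatrix e.symm e.symm :=
        fun M => by
          rw [← Matrix.submatrix_mul_equiv _ _ _ e.symm]
          simp [Q']
      have h1 := hR x₀ hs (U * Q' * U.transpose) ?_ ?_ ?_
      · have h2 : Q' = U.transpose * (U * Q' * U.transpose) * U := by
          rw [mul_assoc U, ← mul_assoc U.transpose, hUU, one_mul, mul_assoc, hUU, mul_one]
        rw [h1, mul_zero, zero_mul] at h2
        ext i j
        have h3 := congrFun (congrFun h2 i) j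
        simpa [Q', e] using h3
      · have h2 : Q'.transpose = Q' := by
          simp [Q', Matrix.transpose_submatrix, Matrix.fromBlocks_transpose, hQ.eq]
        rw [Matrix.IsSymm, Matrix.transpose_mul, Matrix.transpose_mul, h2,
          Matrix.transpose_transpose, mul_assoc]
      · have h2 : pencil R x₀ = U * Matrix.diagonal c * U.transpose := by
          rw [← hdiag, mul_assoc U.transpose, ← mul_assoc U, hUU', one_mul, mul_assoc, hUU',
            mul_one]
        have h3 : Matrix.diagonal c * Q' = 0 := by
          rw [hQ', ← hdiag, ← hNdef, hNx₀, Matrix.fromBlocks_multiply]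
          simp
        rw [h2, mul_assoc, ← mul_assoc U.transpose, ← mul_assoc U.transpose, hUU, one_mul,
          mul_assoc, ← mul_assoc (Matrix.diagonal c), h3]
        simp
      · intro y
        rw [← mul_assoc, Matrix.trace_mul_comm, ← mul_assoc, ← mul_assoc, hQ', ← hNdef,
          ← Matrix.fromBlocks_toBlocks (N y), Matrix.fromBlocks_multiply]
        have h2 : ∀ M : Matrix ({i // p i} ⊕ {i // ¬ p i}) ({i // p i} ⊕ {i // ¬ p i}) ℝ,
            (M.submatrix e.symm e.symm).trace = M.trace := fun M => by
          simp only [Matrix.trace, Matrix.diag_apply, Matrix.submatrix_apply]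
          exact Equiv.sum_comp e.symm fun i => M i i
        rw [h2]
        refine Eq.trans ?_ (htr y)
        simp [Matrix.trace, Fintype.sum_sum_type, N₂₂]
  have hG : HasFDerivAt (fun x : EuclideanSpace ℝ (Fin (l + 1)) => (F x, ‖x‖ ^ 2 - 1))
      (F'.prod (2 • innerSL ℝ x₀)) x₀ :=
    hF'.prodMk ((hasStrictFDerivAt_norm_sq x₀).hasFDerivAt.sub_const 1)
  have hnorm : ‖x₀‖ = 1 := by simpa [unitSphere] using hs
  refine ⟨Sym2 {i // ¬ p i}, inferInstance, fun x => (F x, ‖x‖ ^ 2 - 1), ?_, ?_, ?_, ?_⟩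
  · rw [Sym2.card, hcard']
  · exact hF.prodMk ((contDiff_norm_sq ℝ).sub contDiff_const)
  · rw [hG.fderiv]
    rintro ⟨w, t⟩
    obtain ⟨y, hy⟩ := hsurj fun z => (Matrix.diagonal fun i : {i // p i} => c i).det⁻¹ * w z
    have hF'x₀ : F' x₀ = 0 := by
      ext z
      rw [hF'eq, hNx₀]
      simp
    -- moving along `x₀` changes the norm and, as `F' x₀ = 0`, none of the other coordinates
    refine ⟨y + (t / 2 - inner ℝ x₀ y) • x₀, Prod.ext ?_ ?_⟩
    · change F' _ = w
      rw [map_add, map_smul, hF'x₀, smul_zero, add_zero]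
      ext z
      rw [hF'eq]
      change _ * N₂₂ y _ _ = _
      rw [hy, mul_inv_cancel_left₀ hdet]
    · change (2 • innerSL ℝ x₀) _ = t
      simp only [smul_apply, innerSL_apply_apply, inner_add_right,
        inner_smul_right, real_inner_self_eq_norm_sq, hnorm]
      simp
      ring
  · filter_upwards [hev] with x hx
    rw [Prod.mk_eq_zero, hx, hNrank, hcard, corankLocus, Set.mem_ofPred_eq, unitSphere,
      mem_sphere_zero_iff_norm, sub_eq_zero,
      pow_eq_one_iff_of_nonneg (norm_nonneg x) two_ne_zero]
    constructor
    · rintro ⟨h1, h2⟩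
      exact ⟨h2, by omega⟩
    · rintro ⟨h1, h2⟩
      exact ⟨by omega, h1⟩

/-- The nonempty relatively open subsets of a corank locus of a transversal pencil have the expected
codimension. -/
theorem hasCodimensionInSphere_of_isTransversal {l n k : ℕ} {R : Fin l → SymMat n}
    (hR : IsTransversal R) {A : Set (EuclideanSpace ℝ (Fin (l + 1)))} (hA : A.Nonempty)
    (hsub : A ⊆ corankLocus R k)
    (hopen : ∀ x₀ ∈ A, ∀ᶠ x in 𝓝 x₀, x ∈ corankLocus R k → x ∈ A) :
    HasCodimensionInSphere A ((k + 1).choose 2) := by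
  obtain ⟨x₀, hx₀⟩ := hA
  obtain ⟨ι, _, F, hι, hF, hsurj, hev⟩ := exists_equations_corankLocus hR (hsub hx₀)
  have hle : (k + 1).choose 2 + 1 ≤ l + 1 := by
    have h1 := LinearMap.finrank_le_finrank_of_surjective (f := (fderiv ℝ F x₀).toLinearMap) hsurj
    rwa [finrank_prod, finrank_fintype_fun_eq_card, finrank_self, hι,
      finrank_euclideanSpace_fin] at h1
  refine ⟨fun x hx => (hsub hx).1, l - (k + 1).choose 2, ⟨?_, ?_⟩, by omega⟩
  · refine containsSubmanifold_of_submersion hF hsurj (hev.self_of_nhds.2 (hsub hx₀)) ?_ ?_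
    · filter_upwards [hev, hopen x₀ hx₀] with x h1 h2 h3 using h2 (h1.1 h3)
    · rw [finrank_prod, finrank_fintype_fun_eq_card, finrank_self, hι]
      omega
  · rintro e ⟨V, ψ, hV, ⟨v, hv⟩, hψ, hinj, -, hmaps⟩
    obtain ⟨ι, _, F, hι, hF, hsurj, hev⟩ := exists_equations_corankLocus hR (hsub (hmaps hv))
    have hψv := (hψ.contDiffAt (hV.mem_nhds hv))
    have h1 := add_finrank_le_of_immersion ((hF.differentiable (by simp)) (ψ v)) hsurj
      (hψv.differentiableAt (by simp)) (hinj v hv) (by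
        filter_upwards [hψv.continuousAt.eventually hev, hV.mem_nhds hv] with w h1 h2
        exact h1.2 (hsub (hmaps h2)))
    rw [finrank_prod, finrank_fintype_fun_eq_card, finrank_self, hι] at h1
    omega

/-! ### Semialgebraicity -/

namespace IsSemialgebraic

variable {m : ℕ} {A B : Set (EuclideanSpace ℝ (Fin m))}

theorem inter (hA : IsSemialgebraic A) (hB : IsSemialgebraic B) : IsSemialgebraic (A ∩ B) := by
  rw [← compl_compl (A ∩ B), Set.compl_inter]
  exact ((hA.compl).union _ _ hB.compl).compl

theorem setOf_eval_nonneg (p : MvPolynomial (Fin m) ℝ) :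
    IsSemialgebraic {x : EuclideanSpace ℝ (Fin m) | 0 ≤ MvPolynomial.eval (fun i => x i) p} := by
  convert! (pos (-p)).compl using 1
  ext x
  simp

theorem setOf_eval_eq_zero (p : MvPolynomial (Fin m) ℝ) :
    IsSemialgebraic {x : EuclideanSpace ℝ (Fin m) | MvPolynomial.eval (fun i => x i) p = 0} := by
  convert! (setOf_eval_nonneg p).inter (setOf_eval_nonneg (-p)) using 1
  ext x
  simp [le_antisymm_iff, and_comm]

theorem forall_mem_finset {ι : Type*} (s : Finset ι) {P : ι → EuclideanSpace ℝ (Fin m) → Prop}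
    (h : ∀ i ∈ s, IsSemialgebraic {x | P i x}) : IsSemialgebraic {x | ∀ i ∈ s, P i x} := by
  classical
  induction s using Finset.induction_on with
  | empty =>
    convert! setOf_eval_eq_zero (0 : MvPolynomial (Fin m) ℝ) using 1
    ext x
    simp
  | insert a s ha ih =>
    convert! (h a (Finset.mem_insert_self a s)).inter
      (ih fun i hi => h i (Finset.mem_insert_of_mem hi)) using 1
    ext x
    simp

end IsSemialgebraic

theorem exists_eval_eq_charpoly_neg_pencil_coeff {l n : ℕ} (R : Fin l → SymMat n) (j : ℕ) :
    ∃ p : MvPolynomial (Fin (l + 1)) ℝ, ∀ x : EuclideanSpace ℝ (Fin (l + 1)),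
      MvPolynomial.eval (fun i => x i) p = (-pencil R x).charpoly.coeff j := by
  refine ⟨(-symPencil (fun t => MvPolynomial.C ((R t.1).1 (Quot.out t.2).1 (Quot.out t.2).2))
    MvPolynomial.X).charpoly.coeff j, fun x => ?_⟩
  rw [← Polynomial.coeff_map, ← Matrix.charpoly_map, ← symPencil_out]
  congr 2
  have h := map_symPencil (MvPolynomial.eval fun i => x i)
    (fun t => MvPolynomial.C ((R t.1).1 (Quot.out t.2).1 (Quot.out t.2).2)) MvPolynomial.X
  simp only [MvPolynomial.eval_C, MvPolynomial.eval_X] at h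
  rw [← h]
  ext a b
  simp

theorem isSemialgebraic_corankLocus {l n : ℕ} (R : Fin l → SymMat n) (k : ℕ) :
    IsSemialgebraic (corankLocus R k) := by
  choose p hp using exists_eval_eq_charpoly_neg_pencil_coeff R
  have h1 := (IsSemialgebraic.setOf_eval_eq_zero
    (∑ i, MvPolynomial.X i ^ 2 - 1 : MvPolynomial (Fin (l + 1)) ℝ)).inter
      ((IsSemialgebraic.forall_mem_finset (Finset.range k)
        fun j _ => IsSemialgebraic.setOf_eval_eq_zero (p j)).inter
          (IsSemialgebraic.setOf_eval_eq_zero (p k)).compl)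
  convert! h1 using 1
  ext x
  rw [corankLocus, Set.mem_ofPred_eq, (pencil_isSymm R x).rank_add_eq_iff, unitSphere,
    mem_sphere_zero_iff_norm,
    ← pow_eq_one_iff_of_nonneg (norm_nonneg x) two_ne_zero, EuclideanSpace.norm_sq_eq]
  simp [hp, sub_eq_zero]

theorem isSemialgebraic_setOf_pencil_posSemidef {l n : ℕ} (R : Fin l → SymMat n) :
    IsSemialgebraic {x | (pencil R x).PosSemidef} := by
  choose p hp using exists_eval_eq_charpoly_neg_pencil_coeff R
  simp only [(pencil_isSymm R _).posSemidef_iff_charpoly_neg_coeff_nonneg, ← hp]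
  exact IsSemialgebraic.forall_mem_finset _ fun j _ => IsSemialgebraic.setOf_eval_nonneg (p j)

/-! ### Spectrahedra and symmetroids -/

/-- The positive semidefinite matrices form a relatively open subset of each corank locus: the
coefficients of the characteristic polynomial that are not forced to vanish stay positive. -/
theorem eventually_posSemidef_of_mem_corankLocus {l n k : ℕ} {R : Fin l → SymMat n}
    {x₀ : EuclideanSpace ℝ (Fin (l + 1))} (hx₀ : x₀ ∈ corankLocus R k)
    (hp : (pencil R x₀).PosSemidef) :
    ∀ᶠ x in 𝓝 x₀, x ∈ corankLocus R k → (pencil R x).PosSemidef := by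
  choose p hpe using exists_eval_eq_charpoly_neg_pencil_coeff R
  have hcont : ∀ j, Continuous fun x : EuclideanSpace ℝ (Fin (l + 1)) =>
      MvPolynomial.eval (fun i => x i) (p j) := fun j =>
    (MvPolynomial.continuous_eval (p j)).comp (by fun_prop)
  have h1 : ∀ᶠ x in 𝓝 x₀, ∀ j ∈ Finset.Icc k n, 0 < MvPolynomial.eval (fun i => x i) (p j) := by
    refine (Finset.eventually_all _).2 fun j hj => ?_
    refine (hcont j).continuousAt.eventually_const_lt ?_
    obtain ⟨h1, h2⟩ := Finset.mem_Icc.1 hj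
    beta_reduce
    rw [hpe]
    exact hp.charpoly_neg_coeff_pos (pencil_isSymm R x₀) hx₀.2 h1 h2
  filter_upwards [h1] with x hx hxk
  refine (pencil_isSymm R x).posSemidef_iff_charpoly_neg_coeff_nonneg.2 fun j hj => ?_
  by_cases hkj : k ≤ j
  · rw [← hpe]
    exact (hx j (Finset.mem_Icc.2 ⟨hkj, Nat.lt_succ_iff.1 (Finset.mem_range.1 hj)⟩)).le
  · exact ((((pencil_isSymm R x).rank_add_eq_iff k).1 hxk.2).1 j (not_le.1 hkj)).ge

theorem proposition4p1 (l n : ℕ) :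
    ForGenericTuple (fun R : Fin l → SymMat n => ∀ k : ℕ,
      (spectrahedron R ∩ corankLocus R k = ∅ ∨
        (IsSemialgebraic (spectrahedron R ∩ corankLocus R k) ∧
          HasCodimensionInSphere (spectrahedron R ∩ corankLocus R k) ((k + 1).choose 2))) ∧
      (symmetroid R ∩ corankLocus R k = ∅ ∨
        (IsSemialgebraic (symmetroid R ∩ corankLocus R k) ∧
          HasCodimensionInSphere (symmetroid R ∩ corankLocus R k) ((k + 1).choose 2)))) := by
  obtain ⟨p, hp, h⟩ := forGenericTuple_isTransversal l n
  refine ⟨p, hp, fun R hpR k => ?_⟩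
  have hR := h R hpR
  constructor
  · have heq : spectrahedron R ∩ corankLocus R k =
        {x | (pencil R x).PosSemidef} ∩ corankLocus R k := by
      ext x
      exact ⟨fun hx => ⟨hx.1.2, hx.2⟩, fun hx => ⟨⟨hx.2.1, hx.1⟩, hx.2⟩⟩
    rw [heq]
    refine (Set.eq_empty_or_nonempty _).imp id fun hne => ⟨?_, ?_⟩
    · exact (isSemialgebraic_setOf_pencil_posSemidef R).inter (isSemialgebraic_corankLocus R k)
    · refine hasCodimensionInSphere_of_isTransversal hR hne Set.inter_subset_right ?_
      rintro x₀ ⟨h1, h2⟩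
      filter_upwards [eventually_posSemidef_of_mem_corankLocus h2 h1] with x hx hxk
      exact ⟨hx hxk, hxk⟩
  · rcases Nat.eq_zero_or_pos k with rfl | hk
    · left
      refine Set.eq_empty_of_forall_notMem fun x hx => ?_
      have h1 := (((pencil_isSymm R x).rank_add_eq_iff 0).1 hx.2.2).2
      have h2 := Matrix.det_eq_sign_charpoly_coeff (-pencil R x)
      rw [Matrix.det_neg, hx.1.2, mul_zero] at h2
      exact mul_ne_zero (by simp) h1 h2.symm
    · have heq : symmetroid R ∩ corankLocus R k = corankLocus R k := by
        refine Set.inter_eq_right.2 fun x hx => ⟨hx.1, ?_⟩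
        by_contra hdet
        have h1 := Matrix.rank_of_det_ne_zero hdet
        rw [Fintype.card_fin] at h1
        have := hx.2
        omega
      rw [heq]
      refine (Set.eq_empty_or_nonempty _).imp id fun hne =>
        ⟨isSemialgebraic_corankLocus R k, ?_⟩
      exact hasCodimensionInSphere_of_isTransversal hR hne subset_rfl
        fun x₀ _ => Eventually.of_forall fun x hx => hx
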